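/- A clutter over a finite ground set $V$ is a family $\mathcal{C}$ of subsets of $V$ (its members), none of which contains another one. It is ideal if the polyhedron $\{x\in\mathbb{R}^V : \sum_{u\in C}x_u\ge 1 \text{ for all } C\in\mathcal{C},\ x\ge \mathbf{0}\}$ is integral, that is, equal to the convex hull of the integer vectors it contains. A filter oracle for $\mathcal{C}$ tells, for any queried set $X\subseteq V$, whether or not $X$ contains a member of $\mathcal{C}$. Theorem. Let $n\ge 2$, let $V$ be a set with $2n$ elements, and let $\mathfrak{A}$ be a deterministic (adaptive) algorithm that, given any clutter $\mathcal{C}$ over $V$ via a filter oracle, decides whether or not $\mathcal{C}$ is ideal. Then in the worst case $\mathfrak{A}$ makes at least $2^n$ calls to the filter oracle: there is a clutter $\mathcal{C}$ over $V$ on which $\mathfrak{A}$ makes at least $2^n$ oracle calls before it halts. -/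

import Mathlib

/-- A clutter over the ground set `V`: a family of finite subsets of `V`, its members, none of
which contains another one. -/
structure Clutter (V : Type*) where
  members : Set (Finset V)
  antichain : IsAntichain (· ⊆ ·) members

namespace Clutter

variable {V : Type*}

/-- The set covering polyhedron `{x ∈ ℝ^V : ∑_{u ∈ C} x_u ≥ 1 for every member C, x ≥ 0}`. -/
def coveringPolyhedron (C : Clutter V) : Set (V → ℝ) :=
  {x | (∀ A ∈ C.members, 1 ≤ ∑ u ∈ A, x u) ∧ ∀ u, 0 ≤ x u}

/-- A clutter is ideal if its set covering polyhedron is integral, that is, equal to the convex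
hull of the integer vectors it contains. -/
def IsIdeal (C : Clutter V) : Prop :=
  convexHull ℝ {x | x ∈ C.coveringPolyhedron ∧ ∀ u, ∃ z : ℤ, x u = z} = C.coveringPolyhedron

open Classical in
/-- The filter oracle of a clutter: on the query `X` it tells whether `X` contains a member. -/
noncomputable def filterOracle (C : Clutter V) (X : Finset V) : Bool :=
  decide (∃ A ∈ C.members, A ⊆ X)

end Clutter

/-- What an algorithm with access to an oracle on the subsets of `V` does next: it calls the
oracle on a set `X`, or it stops and outputs a yes/no answer. -/
inductive OracleAction (V : Type*) where
  | query (X : Finset V)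
  | output (b : Bool)

/-- A deterministic adaptive algorithm over the known ground set `V`, seen through its oracle
calls: its next action is an arbitrary function of the replies that it has received so far (the
list of the replies in the order of the calls). Computation between the calls is unrestricted and
free of charge, and the algorithm need not halt on every oracle. -/
structure OracleAlgorithm (V : Type*) where
  next : List Bool → OracleAction V

namespace OracleAlgorithm

variable {V : Type*}

/-- The replies received within the first `k` steps of the run of the algorithm on the oracle
`O`; the list stays constant once the algorithm has stopped. -/
def replies (A : OracleAlgorithm V) (O : Finset V → Bool) : ℕ → List Bool
  | 0 => []
  | k + 1 =>
    match A.next (A.replies O k) with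
    | .query X => A.replies O k ++ [O X]
    | .output _ => A.replies O k

/-- On the oracle `O` the algorithm makes exactly `k` oracle calls and then outputs `b`. -/
def HaltsAfter (A : OracleAlgorithm V) (O : Finset V → Bool) (k : ℕ) (b : Bool) : Prop :=
  (∀ j < k, ∃ X, A.next (A.replies O j) = .query X) ∧ A.next (A.replies O k) = .output b

/-- Given any clutter over `V` through its filter oracle, the algorithm halts and decides
correctly whether the clutter is ideal. -/
def DecidesIdealness (A : OracleAlgorithm V) : Prop :=
  ∀ C : Clutter V, ∃ (k : ℕ) (b : Bool),
    A.HaltsAfter C.filterOracle k b ∧ (b = true ↔ C.IsIdeal)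

end OracleAlgorithm

/-!
Identify `V` with `ι × Bool`, where `|ι| = n`, so that `V` is split into `n` pairs and the
transversals of the pairs are the vertices of the cube `ι → Bool`. For a set `T` of vertices let
`cubeClutter e T` consist of all pairs and of the transversals in `T`. Its filter oracle answers
independently of `T` on every set that is not a transversal, and on a transversal it tells whether
the vertex is in `T`. So the algorithm has to decide a property of `T` from queries of the form
`p ∈ T`.

The property is independence in the graph of the cube: `cubeClutter e T` is ideal if and only if
`T` has no two adjacent vertices (`Clutter.isIdeal_cubeClutter_iff`). Two adjacent vertices give a
half-integral point outside the integer hull. If `T` is independent, its vertices can be added one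
at a time: the constraint of a new vertex `p` cuts off a part of the polyhedron, and the new face
is spanned, up to the nonnegative orthant, by the characteristic vectors of the complements of the
neighbours of `p`. These are in the polyhedron because `T` contains no neighbour of `p`.

Independence is evasive, by the parity argument of Rivest and Vuillemin. Translation of the cube
along one coordinate is an involution of the nonempty independent sets without fixed points, so the
number of independent sets is odd (`odd_card_cubeIndependent`). If every run made fewer than `2 ^ n`
calls, each run would leave some transversal unqueried. Toggling that vertex in `T` would not change
the run, and would therefore be an involution without fixed points of the independent sets, so their
number would be even.
-/

section

open Finset
open scoped Pointwise

/-! ### Runs of an oracle algorithm -/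

namespace OracleAlgorithm

variable {V : Type*} (A : OracleAlgorithm V) {O O' : Finset V → Bool}

theorem HaltsAfter.unique {A : OracleAlgorithm V} {k k' : ℕ} {b b' : Bool}
    (h : A.HaltsAfter O k b) (h' : A.HaltsAfter O k' b') : k = k' ∧ b = b' := by
  obtain ⟨h1, h2⟩ := h
  obtain ⟨h1', h2'⟩ := h'
  rcases lt_trichotomy k k' with hlt | rfl | hlt
  · obtain ⟨X, hX⟩ := h1' k hlt
    simp [hX] at h2
  · simpa [h2] using h2'
  · obtain ⟨X, hX⟩ := h1 k' hlt
    simp [hX] at h2'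

theorem replies_congr
    (h : ∀ j X, A.next (A.replies O j) = .query X → O' X = O X) :
    A.replies O' = A.replies O := by
  funext j
  induction j with
  | zero => rfl
  | succ j ih =>
    cases hX : A.next (A.replies O j) with
    | query X => simp only [replies, ih, hX, h j X hX]
    | output b => simp only [replies, ih, hX]

theorem HaltsAfter.next_of_le {A : OracleAlgorithm V} {k : ℕ} {b : Bool}
    (h : A.HaltsAfter O k b) {j : ℕ} (hj : k ≤ j) : A.next (A.replies O j) = .output b := by
  suffices A.replies O j = A.replies O k by rw [this]; exact h.2
  induction j, hj using Nat.le_induction with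
  | base => rfl
  | succ j _ ih => simp only [replies, ih, h.2]

/-- A run with fewer than `|P|` calls leaves one of the sets `t p`, `p : P`, unqueried for ever. -/
theorem HaltsAfter.exists_not_query {P : Type*} [Fintype P] {A : OracleAlgorithm V} {k : ℕ}
    {b : Bool} (h : A.HaltsAfter O k b) {t : P → Finset V} (ht : Function.Injective t)
    (hk : k < Fintype.card P) : ∃ p, ∀ j, A.next (A.replies O j) ≠ .query (t p) := by
  by_contra! hq
  choose f hf using hq
  have hlt : ∀ p, f p < k := fun p => by
    by_contra! hle
    have := h.next_of_le hle
    simp [hf p] at this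
  have hinj : Function.Injective fun p => (⟨f p, hlt p⟩ : Fin k) := fun p q hpq => by
    have hfpq : f p = f q := by simpa using hpq
    have := hf p
    rw [hfpq, hf q] at this
    exact ht (by simpa using this.symm)
  have := Fintype.card_le_of_injective _ hinj
  simp at this
  omega

end OracleAlgorithm

/-! ### Independent sets of the cube -/

theorem even_card_of_involution {α : Type*} {s : Finset α} {g : α → α}
    (hmem : ∀ a ∈ s, g a ∈ s) (hg : ∀ a ∈ s, g (g a) = a) (hne : ∀ a ∈ s, g a ≠ a) :
    Even s.card := by
  have h : ∑ _a ∈ s, (1 : ZMod 2) = 0 :=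
    Finset.sum_involution (fun a _ => g a) (fun _ _ => by decide) (fun a ha _ => hne a ha)
      hmem hg
  rw [Finset.sum_const, nsmul_eq_mul, mul_one] at h
  exact (ZMod.natCast_eq_zero_iff_even).1 h

variable {ι : Type*}

/-- The neighbour of `p` in the cube `ι → Bool` across direction `i`. -/
def flipAt [DecidableEq ι] (i : ι) (p : ι → Bool) : ι → Bool :=
  Function.update p i (!p i)

section flipAt

variable [DecidableEq ι]

@[simp] theorem flipAt_self (i : ι) (p : ι → Bool) : flipAt i p i = !p i := by simp [flipAt]

theorem flipAt_of_ne {i j : ι} (h : j ≠ i) (p : ι → Bool) : flipAt i p j = p j := by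
  simp [flipAt, h]

theorem flipAt_flipAt (i : ι) (p : ι → Bool) : flipAt i (flipAt i p) = p := by
  simp [flipAt]

/-- The set `T` of vertices of the cube contains no two adjacent ones. -/
def CubeIndependent (T : Finset (ι → Bool)) : Prop :=
  ∀ p ∈ T, ∀ i, flipAt i p ∉ T

open Classical in
/-- Translation along one coordinate is an involution of the independent sets. A set that it fixes
contains the neighbour of each of its vertices, so the empty set is the only fixed one. -/
theorem odd_card_cubeIndependent [Fintype ι] [Nonempty ι] :
    Odd (univ.filter fun T : Finset (ι → Bool) => CubeIndependent T).card := by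
  obtain ⟨i⟩ := ‹Nonempty ι›
  set s := univ.filter fun T : Finset (ι → Bool) => CubeIndependent T with hs
  have hempty : ∅ ∈ s := mem_filter.2 ⟨mem_univ _, fun p hp => absurd hp (notMem_empty p)⟩
  have hinv : ∀ T : Finset (ι → Bool), (T.image (flipAt i)).image (flipAt i) = T := fun T => by
    rw [image_image]
    convert T.image_id
    funext p
    exact flipAt_flipAt i p
  have hcomm : ∀ (j : ι) (p : ι → Bool), flipAt j (flipAt i p) = flipAt i (flipAt j p) := by
    intro j p
    funext k
    by_cases hj : k = j <;> by_cases hi : k = i <;> simp_all [flipAt, Function.update_apply]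
  have heven : Even (s.erase ∅).card := by
    refine even_card_of_involution (g := fun T => T.image (flipAt i)) ?_ ?_ ?_
    · intro T hT
      simp only [mem_erase, hs, mem_filter, mem_univ, true_and] at hT ⊢
      refine ⟨by simpa [image_eq_empty] using hT.1, ?_⟩
      intro p hp j hj
      obtain ⟨q, hq, rfl⟩ := mem_image.1 hp
      obtain ⟨r, hr, hrq⟩ := mem_image.1 hj
      rw [hcomm] at hrq
      have := congrArg (flipAt i) hrq
      rw [flipAt_flipAt, flipAt_flipAt] at this
      exact hT.2 q hq j (this ▸ hr)
    · intro T _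
      exact hinv T
    · intro T hT hTi
      simp only [mem_erase, hs, mem_filter, mem_univ, true_and] at hT
      obtain ⟨p, hp⟩ := nonempty_iff_ne_empty.2 hT.1
      refine hT.2 p hp i ?_
      have := mem_image_of_mem (flipAt i) hp
      rwa [show T.image (flipAt i) = T from hTi] at this
  rw [← card_erase_add_one hempty]
  exact heven.add_one

end flipAt

/-! ### Set covering polyhedra -/

theorem mem_convexHull_natCast {r : ℝ} (hr : 0 ≤ r) :
    r ∈ convexHull ℝ (Set.range ((↑) : ℕ → ℝ)) := by
  refine segment_subset_convexHull (x := (0 : ℝ)) (y := (⌈r⌉₊ : ℝ))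
    (Set.mem_range.2 ⟨0, by simp⟩) (Set.mem_range_self _) ?_
  rw [segment_eq_Icc (Nat.cast_nonneg _)]
  exact ⟨hr, Nat.le_ceil r⟩

namespace Clutter

section polyhedron

variable {V : Type*} (C : Clutter V)

/-- The integer vectors of the set covering polyhedron. -/
def integerPoints : Set (V → ℝ) :=
  {x | x ∈ C.coveringPolyhedron ∧ ∀ u, ∃ z : ℤ, x u = z}

theorem convex_coveringPolyhedron : Convex ℝ C.coveringPolyhedron := by
  rintro x ⟨hx, hx0⟩ y ⟨hy, hy0⟩ a b ha hb hab
  refine ⟨fun A hA => ?_, fun u => ?_⟩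
  · simp only [Pi.add_apply, Pi.smul_apply, smul_eq_mul, sum_add_distrib, ← mul_sum]
    nlinarith [mul_le_mul_of_nonneg_left (hx A hA) ha, mul_le_mul_of_nonneg_left (hy A hA) hb]
  · have := mul_nonneg ha (hx0 u)
    have := mul_nonneg hb (hy0 u)
    simp only [Pi.add_apply, Pi.smul_apply, smul_eq_mul]
    linarith

theorem convexHull_integerPoints_subset :
    convexHull ℝ C.integerPoints ⊆ C.coveringPolyhedron :=
  convexHull_min (fun _ h => h.1) C.convex_coveringPolyhedron

theorem isIdeal_iff : C.IsIdeal ↔ C.coveringPolyhedron ⊆ convexHull ℝ C.integerPoints :=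
  ⟨fun h => h.ge, fun h => C.convexHull_integerPoints_subset.antisymm h⟩

/-- The integer hull of a set covering polyhedron is upward closed: it absorbs the nonnegative
orthant, which is the convex hull of its own integer points. -/
theorem mem_convexHull_integerPoints_of_le [Finite V] {x y : V → ℝ}
    (hx : x ∈ convexHull ℝ C.integerPoints) (hxy : x ≤ y) :
    y ∈ convexHull ℝ C.integerPoints := by
  set N : Set (V → ℝ) := Set.univ.pi fun _ => Set.range ((↑) : ℕ → ℝ) with hN
  have hsub : C.integerPoints + N ⊆ C.integerPoints := by
    rintro _ ⟨z, ⟨⟨hz1, hz2⟩, hzi⟩, m, hm, rfl⟩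
    have hm' : ∀ u, ∃ k : ℕ, (k : ℝ) = m u := fun u => hm u trivial
    have hm0 : ∀ u, 0 ≤ m u := fun u => by
      obtain ⟨k, hk⟩ := hm' u
      rw [← hk]
      exact k.cast_nonneg
    refine ⟨⟨fun A hA => (hz1 A hA).trans (sum_le_sum fun u _ => ?_), fun u => ?_⟩, fun u => ?_⟩
    · exact le_add_of_nonneg_right (hm0 u)
    · exact add_nonneg (hz2 u) (hm0 u)
    · obtain ⟨k, hk⟩ := hm' u
      obtain ⟨l, hl⟩ := hzi u
      exact ⟨l + k, by simp [← hk, hl]⟩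
  have hd : y - x ∈ convexHull ℝ N := by
    rw [hN, convexHull_pi]
    exact fun u _ => mem_convexHull_natCast (sub_nonneg.2 (hxy u))
  have := Set.add_mem_add hx hd
  rw [← convexHull_add, add_sub_cancel] at this
  exact convexHull_mono hsub this

end polyhedron

/-! ### Clutters from sets of cube vertices -/

section cube

variable {V ι : Type*} (e : ι × Bool ≃ V)

theorem pairing_injective (i : ι) : Function.Injective fun b => e (i, b) :=
  fun _ _ h => by simpa using h

theorem section_injective (p : ι → Bool) : Function.Injective fun i => e (i, p i) :=
  fun _ _ h => congrArg Prod.fst (e.injective h)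

/-- The two elements of `V` that encode coordinate `i` of the cube. -/
def pair (i : ι) : Finset V :=
  univ.map ⟨fun b => e (i, b), pairing_injective e i⟩

/-- The vertex `p` of the cube as a subset of `V`: it has one element of each pair. -/
def transversal [Fintype ι] (p : ι → Bool) : Finset V :=
  univ.map ⟨fun i => e (i, p i), section_injective e p⟩

theorem mem_pair {i j : ι} {b : Bool} : e (j, b) ∈ pair e i ↔ i = j := by
  simp [pair]

theorem pair_subset {i : ι} {X : Finset V} : pair e i ⊆ X ↔ ∀ b, e (i, b) ∈ X := by
  simp [pair, subset_iff, or_imp, forall_and]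

/-- The characteristic vector of a transversal. -/
def transversalVector (p : ι → Bool) : V → ℝ :=
  fun v => if p (e.symm v).1 = (e.symm v).2 then 1 else 0

theorem transversalVector_apply {p : ι → Bool} {i : ι} {b : Bool} :
    transversalVector e p (e (i, b)) = if p i = b then 1 else 0 := by
  simp [transversalVector]

variable [Fintype ι]

theorem mem_transversal {i : ι} {b : Bool} {p : ι → Bool} :
    e (i, b) ∈ transversal e p ↔ p i = b := by
  simp [transversal]

theorem transversal_subset {p : ι → Bool} {X : Finset V} :
    transversal e p ⊆ X ↔ ∀ i, e (i, p i) ∈ X := by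
  simp [transversal, subset_iff]

theorem eq_of_transversal_subset {p q : ι → Bool} (h : transversal e p ⊆ transversal e q) :
    p = q :=
  funext fun i => ((mem_transversal e).1 ((transversal_subset e).1 h i)).symm

theorem transversal_injective : Function.Injective (transversal e) := fun _ _ h =>
  eq_of_transversal_subset e h.subset

/-- A superset of a transversal that contains no pair is that transversal. -/
theorem eq_transversal_of_subset {p : ι → Bool} {X : Finset V} (h : transversal e p ⊆ X)
    (hX : ∀ i, ¬ pair e i ⊆ X) : X = transversal e p := by
  refine Subset.antisymm (fun v hv => ?_) h
  obtain ⟨⟨i, b⟩, rfl⟩ := e.surjective v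
  rw [mem_transversal]
  by_contra hb
  refine hX i ((pair_subset e).2 fun c => ?_)
  have hi := (transversal_subset e).1 h i
  cases b <;> cases c <;> cases hp : p i <;> simp_all

variable [Nontrivial ι]

/-- The clutter of all pairs and of the transversals in `T`. It needs at least two pairs, since
otherwise a transversal is properly contained in a pair. -/
def cubeClutter (T : Finset (ι → Bool)) : Clutter V where
  members := Set.range (pair e) ∪ transversal e '' T
  antichain := by
    rintro _ (⟨i, rfl⟩ | ⟨p, -, rfl⟩) _ (⟨j, rfl⟩ | ⟨q, -, rfl⟩) hne hsub
    · refine hne (congrArg _ ?_)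
      exact ((mem_pair e).1 ((pair_subset e).1 hsub true)).symm
    · have h1 := (mem_transversal e).1 ((pair_subset e).1 hsub true)
      have h2 := (mem_transversal e).1 ((pair_subset e).1 hsub false)
      simp [h1] at h2
    · obtain ⟨k, hk⟩ := exists_ne j
      exact hk ((mem_pair e).1 ((transversal_subset e).1 hsub k)).symm
    · exact hne (congrArg _ (eq_of_transversal_subset e hsub))

variable {e} {T : Finset (ι → Bool)}

theorem filterOracle_cubeClutter {X : Finset V} :
    (cubeClutter e T).filterOracle X = true ↔
      (∃ i, pair e i ⊆ X) ∨ ∃ p ∈ T, X = transversal e p := by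
  simp only [filterOracle, decide_eq_true_eq]
  constructor
  · rintro ⟨_, ⟨i, rfl⟩ | ⟨p, hp, rfl⟩, hX⟩
    · exact .inl ⟨i, hX⟩
    · by_cases h : ∃ i, pair e i ⊆ X
      · exact .inl h
      · exact .inr ⟨p, hp, eq_transversal_of_subset e hX (not_exists.1 h)⟩
  · rintro (⟨i, hi⟩ | ⟨p, hp, rfl⟩)
    · exact ⟨_, .inl ⟨i, rfl⟩, hi⟩
    · exact ⟨_, .inr ⟨p, hp, rfl⟩, Subset.rfl⟩

theorem filterOracle_cubeClutter_congr {T' : Finset (ι → Bool)} {X : Finset V}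
    (h : ∀ p, X = transversal e p → (p ∈ T ↔ p ∈ T')) :
    (cubeClutter e T).filterOracle X = (cubeClutter e T').filterOracle X := by
  rw [Bool.eq_iff_iff, filterOracle_cubeClutter, filterOracle_cubeClutter]
  refine or_congr_right (exists_congr fun p => ?_)
  constructor <;> rintro ⟨hp, hX⟩
  · exact ⟨(h p hX).1 hp, hX⟩
  · exact ⟨(h p hX).2 hp, hX⟩

theorem mem_coveringPolyhedron_cubeClutter {x : V → ℝ} :
    x ∈ (cubeClutter e T).coveringPolyhedron ↔
      (∀ i, 1 ≤ x (e (i, true)) + x (e (i, false))) ∧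
        (∀ p ∈ T, 1 ≤ ∑ i, x (e (i, p i))) ∧ ∀ u, 0 ≤ x u := by
  simp only [coveringPolyhedron, cubeClutter, Set.mem_ofPred_eq, Set.mem_union, or_imp,
    forall_and, Set.forall_mem_range, Set.forall_mem_image, pair, transversal, sum_map,
    Function.Embedding.coeFn_mk, Fintype.sum_bool, mem_coe, and_assoc]

theorem coveringPolyhedron_cubeClutter_anti {T' : Finset (ι → Bool)} (h : T' ⊆ T) :
    (cubeClutter e T).coveringPolyhedron ⊆ (cubeClutter e T').coveringPolyhedron := by
  intro x hx
  rw [mem_coveringPolyhedron_cubeClutter] at hx ⊢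
  exact ⟨hx.1, fun p hp => hx.2.1 p (h hp), hx.2.2⟩

/-! ### Idealness and independence -/

/-- If `T` contains two adjacent vertices, which differ in coordinate `i` only, then every integer
point of the polyhedron satisfies `x_{i,1} + x_{i,0} + ∑_{k ≠ i} x_{k,p_k} ≥ 2`. A point with the
value `1/2` on two pairs violates this inequality. -/
theorem not_isIdeal_cubeClutter [DecidableEq ι] (hT : ¬ CubeIndependent T) :
    ¬ (cubeClutter e T).IsIdeal := by
  simp only [CubeIndependent, not_forall, not_not] at hT
  obtain ⟨p, hp, i, hpi⟩ := hT
  obtain ⟨j, hji⟩ := exists_ne i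
  rw [isIdeal_iff]
  intro hsub
  set g : (V → ℝ) → ℝ := fun x =>
    x (e (i, true)) + x (e (i, false)) + ∑ k ∈ univ.erase i, x (e (k, p k)) with hg
  have hint : (cubeClutter e T).integerPoints ⊆ {x | 2 ≤ g x} := by
    rintro x ⟨hx, hz⟩
    choose z hz using hz
    rw [mem_coveringPolyhedron_cubeClutter] at hx
    obtain ⟨h1, h2, -⟩ := hx
    have hpair := h1 i
    have hpp := h2 p hp
    have hqq := h2 _ hpi
    rw [← add_sum_erase _ _ (mem_univ i)] at hpp hqq
    rw [sum_congr rfl (g := fun k => x (e (k, p k))) fun k hk => by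
      rw [flipAt_of_ne (ne_of_mem_erase hk)], flipAt_self] at hqq
    simp only [Set.mem_ofPred_eq, hg]
    simp only [hz] at hpair hpp hqq ⊢
    norm_cast at hpair hpp hqq ⊢
    have : 1 ≤ z (e (i, true)) + ∑ k ∈ univ.erase i, z (e (k, p k)) ∧
        1 ≤ z (e (i, false)) + ∑ k ∈ univ.erase i, z (e (k, p k)) := by
      cases hb : p i <;> simp_all
    omega
  have hconv : Convex ℝ {x | 2 ≤ g x} := by
    intro x hx y hy a b ha hb hab
    simp only [Set.mem_ofPred_eq] at hx hy ⊢
    have : g (a • x + b • y) = a * g x + b * g y := by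
      simp only [hg, Pi.add_apply, Pi.smul_apply, smul_eq_mul, sum_add_distrib, ← mul_sum]
      ring
    rw [this]
    nlinarith [mul_le_mul_of_nonneg_left hx ha, mul_le_mul_of_nonneg_left hy hb]
  set w : V → ℝ := fun v =>
    if (e.symm v).1 = i ∨ (e.symm v).1 = j then 1 / 2
    else if p (e.symm v).1 = (e.symm v).2 then 0 else 1 with hw
  have hw0 : ∀ u, 0 ≤ w u := fun u => by
    simp only [hw]
    split_ifs <;> norm_num
  have hwmem : w ∈ (cubeClutter e T).coveringPolyhedron := by
    rw [mem_coveringPolyhedron_cubeClutter]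
    refine ⟨fun k => ?_, fun q _ => ?_, hw0⟩
    · simp only [hw, Equiv.symm_apply_apply]
      cases p k <;> split_ifs <;> norm_num at *
    · have := sum_le_sum_of_subset_of_nonneg (subset_univ {i, j})
        (fun k _ _ => hw0 (e (k, q k)))
      rw [sum_pair hji.symm] at this
      refine le_trans ?_ this
      simp only [hw, Equiv.symm_apply_apply, true_or, or_true, if_true]
      norm_num
  have hgw : g w = 3 / 2 := by
    have : ∑ k ∈ univ.erase i, w (e (k, p k)) = w (e (j, p j)) := by
      refine sum_eq_single_of_mem j (by simp [hji]) fun k hk hkj => ?_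
      simp [hw, ne_of_mem_erase hk, hkj]
    simp only [hg, this]
    simp only [hw, Equiv.symm_apply_apply, true_or, or_true, if_true]
    norm_num
  have := convexHull_min hint hconv (hsub hwmem)
  simp only [Set.mem_ofPred_eq, hgw] at this
  norm_num at this

/-- A transversal meets every other one except its complement, so it covers `T` unless the
complement is in `T`. -/
theorem transversalVector_mem_integerPoints {p : ι → Bool} (hp : (fun i => !p i) ∉ T) :
    transversalVector e p ∈ (cubeClutter e T).integerPoints := by
  have h0 : ∀ u, 0 ≤ transversalVector e p u := fun u => by
    unfold transversalVector
    split_ifs <;> norm_num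
  refine ⟨mem_coveringPolyhedron_cubeClutter.2 ⟨fun i => ?_, fun q hq => ?_, h0⟩, fun u => ?_⟩
  · rw [transversalVector_apply, transversalVector_apply]
    cases p i <;> norm_num
  · obtain ⟨i, hi⟩ : ∃ i, p i = q i := by
      by_contra! h
      refine hp ?_
      convert hq using 1
      funext i
      rw [Bool.eq_not_of_ne (h i), Bool.not_not]
    have := single_le_sum (f := fun i => transversalVector e p (e (i, q i)))
      (fun i _ => h0 _) (mem_univ i)
    rwa [transversalVector_apply, if_pos hi] at this
  · unfold transversalVector
    split_ifs
    · exact ⟨1, by simp⟩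
    · exact ⟨0, by simp⟩

/-- Without transversals, the minimal points of the polyhedron form a cube `[0,1]^ι`, which is the
convex hull of its vertices. -/
theorem isIdeal_cubeClutter_empty [Finite V] : (cubeClutter e ∅).IsIdeal := by
  rw [isIdeal_iff]
  intro x hx
  obtain ⟨hpair, -, hx0⟩ := mem_coveringPolyhedron_cubeClutter.1 hx
  set f : (ι → ℝ) → V → ℝ := fun y v =>
    if (e.symm v).2 then y (e.symm v).1 else 1 - y (e.symm v).1 with hf
  set S : Set (ι → ℝ) := {y | f y ∈ convexHull ℝ (cubeClutter e ∅).integerPoints} with hS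
  have hconv : Convex ℝ S := by
    intro y hy z hz a b ha hb hab
    have : f (a • y + b • z) = a • f y + b • f z := by
      funext v
      simp only [hf, Pi.add_apply, Pi.smul_apply, smul_eq_mul]
      split_ifs
      · rfl
      · linear_combination -hab
    simp only [hS, Set.mem_ofPred_eq, this]
    exact convex_convexHull ℝ _ hy hz ha hb hab
  have hvert : (Set.univ.pi fun _ => ({0, 1} : Set ℝ)) ⊆ S := by
    intro y hy
    have hy' : ∀ i, y i = 0 ∨ y i = 1 := fun i => by simpa using hy i trivial
    have : f y = transversalVector e fun i => decide (y i = 1) := by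
      funext v
      obtain ⟨⟨i, b⟩, rfl⟩ := e.surjective v
      rw [transversalVector_apply]
      simp only [hf, Equiv.symm_apply_apply]
      rcases hy' i with h | h <;> cases b <;> simp [h]
    simp only [hS, Set.mem_ofPred_eq, this]
    exact subset_convexHull ℝ _ (transversalVector_mem_integerPoints (notMem_empty _))
  have hcube := convexHull_min hvert hconv
  rw [convexHull_pi, convexHull_pair, segment_eq_Icc zero_le_one] at hcube
  have hy : (fun i => min 1 (x (e (i, true)))) ∈ S :=
    hcube fun i _ => ⟨le_min zero_le_one (hx0 _), min_le_left _ _⟩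
  refine mem_convexHull_integerPoints_of_le _ hy fun v => ?_
  obtain ⟨⟨i, b⟩, rfl⟩ := e.surjective v
  have h1 := hpair i
  have h2 := hx0 (e (i, false))
  cases b
  · simp only [hf, Equiv.symm_apply_apply, Bool.false_eq_true, if_false]
    rcases min_cases 1 (x (e (i, true))) with h | h <;> linarith
  · simp [hf]

/-- A point that satisfies the constraint of the transversal `p` with equality dominates a convex
combination of the transversals complementary to the neighbours of `p`, which cover `T` if `T`
contains none of these neighbours. -/
theorem mem_convexHull_of_tight [Finite V] [DecidableEq ι] {p : ι → Bool}
    (hT : ∀ i, flipAt i p ∉ T) {x : V → ℝ}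
    (hpair : ∀ i, 1 ≤ x (e (i, true)) + x (e (i, false))) (hx0 : ∀ u, 0 ≤ x u)
    (hp : ∑ i, x (e (i, p i)) = 1) :
    x ∈ convexHull ℝ (cubeClutter e T).integerPoints := by
  have hc : ∀ i, transversalVector e (fun k => !flipAt i p k) ∈
      convexHull ℝ (cubeClutter e T).integerPoints := fun i =>
    subset_convexHull ℝ _ (transversalVector_mem_integerPoints (by simpa using hT i))
  have := (convex_convexHull ℝ (cubeClutter e T).integerPoints).sum_mem
    (t := univ) (w := fun i => x (e (i, p i))) (fun i _ => hx0 _) hp (fun i _ => hc i)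
  refine mem_convexHull_integerPoints_of_le _ this fun v => ?_
  obtain ⟨⟨j, b⟩, rfl⟩ := e.surjective v
  rw [Finset.sum_apply]
  simp only [Pi.smul_apply, smul_eq_mul, transversalVector_apply]
  by_cases hb : p j = b
  · rw [sum_eq_single_of_mem j (mem_univ j) fun i _ hij => by
      rw [flipAt_of_ne hij.symm, hb]; simp]
    simp [hb]
  · obtain rfl : b = !p j := Bool.eq_not_of_ne (Ne.symm hb)
    rw [← add_sum_erase _ _ (mem_univ j)] at hp ⊢
    rw [sum_congr rfl (g := fun i => x (e (i, p i))) fun i hi => by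
      rw [flipAt_of_ne (ne_of_mem_erase hi).symm]; simp]
    have h1 := hpair j
    simp only [flipAt_self]
    cases hpj : p j <;> simp [hpj] at hp ⊢ <;> linarith

/-- Induction on `T`: passing from `T` to `insert p T` loses the integer points that miss the
transversal `p`. A segment from such a point to a remaining point leaves the lost region through
the hyperplane where the constraint of `p` is tight, and that part of the polyhedron is spanned
by integer points that remain (`mem_convexHull_of_tight`). -/
theorem isIdeal_cubeClutter [Finite V] [DecidableEq ι] (hT : CubeIndependent T) :
    (cubeClutter e T).IsIdeal := by
  induction T using Finset.induction_on with
  | empty => exact isIdeal_cubeClutter_empty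
  | insert p T hpT ih =>
    have hnb : ∀ i, flipAt i p ∉ insert p T := hT p (mem_insert_self _ _)
    have ih := (isIdeal_iff _).1 (ih fun q hq i hqi =>
      hT q (mem_insert_of_mem hq) i (mem_insert_of_mem hqi))
    rw [isIdeal_iff]
    intro x hx
    obtain ⟨-, hxp, -⟩ := mem_coveringPolyhedron_cubeClutter.1 hx
    have hxp := hxp p (mem_insert_self _ _)
    have hxT := ih (coveringPolyhedron_cubeClutter_anti (subset_insert _ _) hx)
    set K := convexHull ℝ (cubeClutter e (insert p T)).integerPoints with hK
    set B : Set (V → ℝ) := {z | z ∈ (cubeClutter e ∅).coveringPolyhedron ∧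
      ∑ i, z (e (i, p i)) = 0} with hB
    have hBconv : Convex ℝ B := by
      rintro y ⟨hy, hy0⟩ z ⟨hz, hz0⟩ a b ha hb hab
      refine ⟨convex_coveringPolyhedron _ hy hz ha hb hab, ?_⟩
      simp [sum_add_distrib, ← mul_sum, hy0, hz0]
    have hsplit : (cubeClutter e T).integerPoints ⊆
        B ∪ (cubeClutter e (insert p T)).integerPoints := by
      rintro z ⟨hz, hzi⟩
      obtain ⟨h1, h2, h3⟩ := mem_coveringPolyhedron_cubeClutter.1 hz
      by_cases h0 : ∑ i, z (e (i, p i)) = 0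
      · exact .inl ⟨coveringPolyhedron_cubeClutter_anti (empty_subset _) hz, h0⟩
      · refine .inr ⟨mem_coveringPolyhedron_cubeClutter.2 ⟨h1, ?_, h3⟩, hzi⟩
        rw [forall_mem_insert]
        refine ⟨?_, h2⟩
        have hpos := lt_of_le_of_ne (sum_nonneg fun i _ => h3 (e (i, p i))) (Ne.symm h0)
        choose m hm using hzi
        simp only [hm] at hpos ⊢
        exact_mod_cast hpos
    have hne : (cubeClutter e (insert p T)).integerPoints.Nonempty := by
      obtain ⟨i⟩ : Nonempty ι := inferInstance
      exact ⟨_, transversalVector_mem_integerPoints (e := e) (p := fun k => !flipAt i p k)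
        (by simpa using hnb i)⟩
    rcases B.eq_empty_or_nonempty with hBe | hBne
    · rw [hBe, Set.empty_union] at hsplit
      exact convexHull_mono hsplit hxT
    · have hx' := convexHull_mono hsplit hxT
      rw [convexHull_union hBne hne, hBconv.convexHull_eq, mem_convexJoin] at hx'
      obtain ⟨w, ⟨hw, hw0⟩, z, hz, a, b, ha, hb, hab, rfl⟩ := hx'
      have hzQ := convexHull_integerPoints_subset _ hz
      set l := ∑ i, z (e (i, p i)) with hl
      have hl1 : 1 ≤ l :=
        (mem_coveringPolyhedron_cubeClutter.1 hzQ).2.1 p (mem_insert_self _ _)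
      have hbl : 1 ≤ b * l := by
        simpa [sum_add_distrib, ← mul_sum, hw0] using hxp
      have hl0 : 0 < l := by linarith
      -- The point of the segment from `w` to `z` on the hyperplane of the constraint of `p`.
      set s := l⁻¹ with hs
      have hsl : s * l = 1 := inv_mul_cancel₀ hl0.ne'
      have hs1 : s ≤ 1 := inv_le_one_of_one_le₀ hl1
      have hs0 : 0 < s := inv_pos.2 hl0
      have hsb : s ≤ b := by
        by_contra! h
        nlinarith
      have hy : (1 - s) • w + s • z ∈ K := by
        have hyQ := convex_coveringPolyhedron _ hw
          (coveringPolyhedron_cubeClutter_anti (empty_subset _) hzQ)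
          (sub_nonneg.2 hs1) hs0.le (sub_add_cancel 1 s)
        obtain ⟨h1, -, h3⟩ := mem_coveringPolyhedron_cubeClutter.1 hyQ
        refine mem_convexHull_of_tight hnb h1 h3 ?_
        simp [sum_add_distrib, ← mul_sum, hw0, ← hl, hsl]
      rcases hs1.eq_or_lt with h | h
      · have hb1 : b = 1 := by linarith
        have ha0 : a = 0 := by linarith
        simpa [hb1, ha0] using hz
      · have h1s : 0 < 1 - s := sub_pos.2 h
        have hc := convex_convexHull ℝ _ hy hz (a := a / (1 - s)) (b := (b - s) / (1 - s))
          (by positivity) (div_nonneg (sub_nonneg.2 hsb) h1s.le)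
          (by field_simp; linarith)
        convert hc using 1
        rw [smul_add, smul_smul, smul_smul, add_assoc, ← add_smul]
        congr 2
        · field_simp
        · field_simp
          linear_combination (-s) * hab

theorem isIdeal_cubeClutter_iff [Finite V] [DecidableEq ι] :
    (cubeClutter e T).IsIdeal ↔ CubeIndependent T :=
  ⟨fun h => by_contra fun hT => not_isIdeal_cubeClutter hT h, isIdeal_cubeClutter⟩

end cube

end Clutter

/-! ### The lower bound -/

open Clutter symmDiff

/-- If the run on `cubeClutter e T` never queries the transversal `v`, then the algorithm cannot
distinguish `T` from `T ∆ {v}`. -/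
theorem OracleAlgorithm.replies_cubeClutter_symmDiff {V ι : Type*} {e : ι × Bool ≃ V} [Fintype ι]
    [Nontrivial ι] [DecidableEq ι] {A : OracleAlgorithm V} {T : Finset (ι → Bool)} {v : ι → Bool}
    (hv : ∀ j, A.next (A.replies (cubeClutter e T).filterOracle j) ≠ .query (transversal e v)) :
    A.replies (cubeClutter e (T ∆ {v})).filterOracle =
      A.replies (cubeClutter e T).filterOracle := by
  refine A.replies_congr fun j X hX => filterOracle_cubeClutter_congr ?_
  rintro p rfl
  have hpv : p ≠ v := by
    rintro rfl
    exact hv j hX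
  simp [mem_symmDiff, hpv]

open Classical in
/-- If every run made fewer than `2 ^ |ι|` calls, then toggling a transversal that is never queried
would pair off the ideal clutters among the `cubeClutter e T`, whose number is odd. -/
theorem OracleAlgorithm.DecidesIdealness.exists_haltsAfter {V ι : Type*} (e : ι × Bool ≃ V)
    [Fintype ι] [Nontrivial ι] [Finite V] {A : OracleAlgorithm V} (hA : A.DecidesIdealness) :
    ∃ (C : Clutter V) (k : ℕ) (b : Bool),
      A.HaltsAfter C.filterOracle k b ∧ 2 ^ Fintype.card ι ≤ k := by
  by_contra! hshort
  set O : Finset (ι → Bool) → Finset V → Bool := fun T => (cubeClutter e T).filterOracle with hO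
  -- The chosen vertex depends on the replies only, so it is the same for `T` and its partner.
  set v : (ℕ → List Bool) → ι → Bool := fun r =>
    Classical.epsilon fun p => ∀ j, A.next (r j) ≠ .query (transversal e p) with hv
  have hunq : ∀ T j, A.next (A.replies (O T) j) ≠ .query (transversal e (v (A.replies (O T)))) := by
    intro T
    obtain ⟨k, b, hk, -⟩ := hA (cubeClutter e T)
    refine Classical.epsilon_spec
      (p := fun p => ∀ j, A.next (A.replies (O T) j) ≠ .query (transversal e p)) ?_
    refine hk.exists_not_query (transversal_injective e) ?_
    simpa using hshort _ k b hk
  have hrep : ∀ T, A.replies (O (T ∆ {v (A.replies (O T))})) = A.replies (O T) := fun T =>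
    replies_cubeClutter_symmDiff (hunq T)
  have hodd := odd_card_cubeIndependent (ι := ι)
  refine Nat.not_even_iff_odd.2 hodd ?_
  refine even_card_of_involution (g := fun T => T ∆ {v (A.replies (O T))}) ?_ ?_ ?_
  · intro T hT
    simp only [mem_filter, mem_univ, true_and, ← isIdeal_cubeClutter_iff (e := e)] at hT ⊢
    obtain ⟨k, b, hk, hb⟩ := hA (cubeClutter e T)
    obtain ⟨k', b', hk', hb'⟩ := hA (cubeClutter e (T ∆ {v (A.replies (O T))}))
    have hk'' : A.HaltsAfter (O T) k' b' := by
      rw [HaltsAfter, ← hrep T]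
      exact hk'
    rw [← hb', ← (hk.unique hk'').2]
    exact hb.2 hT
  · intro T _
    simp only [hrep]
    rw [symmDiff_symmDiff_cancel_right]
  · intro T _ h
    have := symmDiff_eq_left.1 h
    simp at this

end

theorem theorem1 {V : Type*} [Fintype V] (n : ℕ) (hn : 2 ≤ n) (hV : Fintype.card V = 2 * n)
    (A : OracleAlgorithm V) (hA : A.DecidesIdealness) :
    ∃ (C : Clutter V) (k : ℕ) (b : Bool),
      A.HaltsAfter C.filterOracle k b ∧ 2 ^ n ≤ k := by
  have : Nontrivial (Fin n) := Fin.nontrivial_iff_two_le.2 hn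
  have e : Fin n × Bool ≃ V := Fintype.equivOfCardEq (by simp [hV, mul_comm])
  simpa using hA.exists_haltsAfter e
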